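/- Let $(\Omega,\mathcal F,P)$ be a probability space with a measurable flow $\theta:\mathbb R\times\Omega\to\Omega$ ($\theta_0=\mathrm{Id}$, $\theta_{t+s}=\theta_t\circ\theta_s$) preserving $P$, and let $(E,d)$ be a complete separable metric space. For a metric space $(S,\rho)$, let $L^0(S)$ be the space of a.e.-equivalence classes of measurable maps $\Omega\to S$ (with separable range, up to a null set), with the distance $d_0(f,g)=\mathbb E(\rho(f,g)\wedge 1)$. For a bounded distance $c$ on a separable metric space $S$ and Borel probability laws $\mu,\nu$ on $S$, let $W_c(\mu,\nu)$ be the infimum of $\int c\,d\pi$ over all laws $\pi$ on $S\times S$ with marginals $\mu,\nu$. A set $A\subset\mathbb R$ is relatively dense if for some $l>0$ every interval of length $l$ meets $A$. A map $x$ from $\mathbb R$ to a space with distance $\rho$ is almost periodic if it is continuous and, for each $\epsilon>0$, the set of $\tau\in\mathbb R$ with $\sup_t\rho(x(t+\tau),x(t))\le\epsilon$ is relatively dense. Let $X:\mathbb R\to L^0(E)$ be a random process, and write $T_tX(s,\omega)=X(t+s,\theta_{-t}\omega)$. * $X$ is $\theta$-almost periodic if $(t,s)\mapsto X(t+s,\theta_{-s}\cdot)\in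 L^0(E)$ is continuous on $\mathbb R^2$ and, for each $\epsilon>0$, the set of $\tau\in\mathbb R$ with $\sup_t d_0(X(t+\tau,\theta_{-\tau}\cdot),X(t,\cdot))\le\epsilon$ is relatively dense. $X$ is $\theta$-periodic if, for some $\tau\ne0$, $X(t+\tau,\theta_{-\tau}\cdot)=X(t,\cdot)$ in $L^0(E)$ for every $t$. * $X$ is almost periodic in finite-dimensional distribution (APFD) if, for all $n$ and $t_1,\dots,t_n\in\mathbb R$, the map sending $t$ to the law of $(T_tX(t_1,\cdot),\dots,T_tX(t_n,\cdot))$ on $E^n$ (with the maximum distance $d_n$) is almost periodic for $W_{d_n\wedge 1}$. $X$ is periodic in finite-dimensional distribution (PFD) if all these maps are $\tau$-periodic for one $\tau>0$ independent of $n,t_1,\dots,t_n$. * $X$ is almost periodic in path distribution (APPD) if it has a modification with continuous trajectories such that, when $T_tX$ is computed with this modification, the map sending $t$ to the law of $T_tX$ on $C(\mathbb R;E)$ is almost periodic for $W_{\delta}$, where $\delta(x,y)=\sum_{k\ge1}2^{-k}\bigl(\sup_{[-k,k]}d(x,y)\wedge1\bigr)$. **Theorem.** If $X$ is $\theta$-almost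 periodic, then $X$ is APFD. If $X$ is $\theta$-periodic, then $X$ is PFD. If $X$ has a modification with continuous trajectories, again denoted by $X$, and if for every compact interval $J$ the map $Z_J:\mathbb R\to L^0(C(J;E))$, $Z_J(t)(\omega)(s)=X(t+s,\theta_{-t}\omega)$ ($s\in J$), is almost periodic, where $C(J;E)$ carries the uniform distance, then $X$ is APPD. -/

import Mathlib

open MeasureTheory Set Filter Topology

noncomputable section

/-! ### Almost periodic functions -/

/-- `A ⊆ ℝ` is relatively dense: for some `l > 0`, every interval of length `l` meets `A`. -/
def IsRelativelyDense (A : Set ℝ) : Prop :=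
  ∃ l : ℝ, 0 < l ∧ ∀ a : ℝ, ∃ τ ∈ A, τ ∈ Icc a (a + l)

/-- Continuity of `x : T → Y` for a distance `d` on `Y`. -/
def IsContinuousFor {T Y : Type*} [TopologicalSpace T] (d : Y → Y → ℝ) (x : T → Y) : Prop :=
  ∀ t₀ : T, Tendsto (fun t => d (x t) (x t₀)) (𝓝 t₀) (𝓝 0)

/-- Bohr almost periodicity of `x : ℝ → Y` for a distance `d` on `Y`: `x` is continuous and, for
every `ε > 0`, the set of its `ε`-almost periods is relatively dense. -/
def IsAlmostPeriodic {Y : Type*} (d : Y → Y → ℝ) (x : ℝ → Y) : Prop :=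
  IsContinuousFor d x ∧
    ∀ ε : ℝ, 0 < ε → IsRelativelyDense {τ : ℝ | ∀ t : ℝ, d (x (t + τ)) (x t) ≤ ε}

/-! ### The distances on spaces of random variables and of laws -/

/-- The distance `E (dist (f, g) ∧ 1)` of convergence in probability, on the space `L⁰(Ω; Y)` of
almost everywhere classes of (strongly) measurable maps. -/
def distL0 {Ω Y : Type*} [MeasurableSpace Ω] {P : Measure Ω} [MetricSpace Y]
    (f g : Ω →ₘ[P] Y) : ℝ :=
  ∫ ω, min (dist (f ω) (g ω)) 1 ∂P

/-- The Wasserstein distance between two laws on `Y`, for a bounded distance `c` on `Y`: the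
infimum of `E c(ξ, η)` over all couplings `(ξ, η)` of `μ` and `ν`, a coupling being given by its
joint law `π`. -/
def wasserstein {Y : Type*} [MeasurableSpace Y] (c : Y → Y → ℝ) (μ ν : ProbabilityMeasure Y) : ℝ :=
  sInf {r : ℝ | ∃ π : ProbabilityMeasure (Y × Y),
    π.map measurable_fst.aemeasurable = μ ∧ π.map measurable_snd.aemeasurable = ν ∧
      r = ∫ p, c p.1 p.2 ∂(π : Measure (Y × Y))}

/-- The truncated distance `dist ∧ 1`. -/
def truncDist {Y : Type*} [MetricSpace Y] (x y : Y) : ℝ := min (dist x y) 1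

/-- The distance `∑_{k ≥ 1} 2⁻ᵏ (sup_{[-k, k]} dist (x, y) ∧ 1)` on `C(ℝ, E)`, which metrizes
the compact-open topology.  The distance of the restrictions to `[-k, k]` is their uniform
distance. -/
def pathDist {E : Type*} [MetricSpace E] (x y : C(ℝ, E)) : ℝ :=
  ∑' k : ℕ, (1 / 2 : ℝ) ^ (k + 1) *
    min (dist (x.restrict (Icc (-((k : ℝ) + 1)) ((k : ℝ) + 1)))
      (y.restrict (Icc (-((k : ℝ) + 1)) ((k : ℝ) + 1)))) 1

/-- Spaces of continuous maps carry the Borel σ-algebra of the compact-open topology (the topology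
of uniform convergence when the source is compact). -/
instance continuousMapMeasurableSpace {S E : Type*} [TopologicalSpace S] [TopologicalSpace E] :
    MeasurableSpace C(S, E) := borel _

instance continuousMapBorelSpace {S E : Type*} [TopologicalSpace S] [TopologicalSpace E] :
    BorelSpace C(S, E) := ⟨rfl⟩

/-- A map into `C(ℝ, E)` with measurable evaluations is Borel measurable. -/
theorem measurable_of_measurable_eval {Ω E : Type*} [MeasurableSpace Ω] [MetricSpace E]
    [SecondCountableTopology E] [MeasurableSpace E] [BorelSpace E]
    (f : Ω → C(ℝ, E)) (hf : ∀ t : ℝ, Measurable fun ω => f ω t) : Measurable f := by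
  have hb : (continuousMapMeasurableSpace : MeasurableSpace C(ℝ, E)) = _ :=
    borel_eq_generateFrom_of_subbasis (ContinuousMap.compactOpen_eq (X := ℝ) (Y := E))
  rw [hb]
  refine measurable_generateFrom ?_
  rintro _ ⟨K, hK, U, hU, rfl⟩
  obtain ⟨s, hsc, hsd⟩ := TopologicalSpace.exists_countable_dense K
  have key : f ⁻¹' {g : C(ℝ, E) | MapsTo g K U} =
      ⋃ n : ℕ, ⋂ d ∈ s, {ω | ((n : ENNReal)⁻¹) ≤ Metric.infEDist (f ω (d : K)) Uᶜ} := by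
    ext ω
    simp only [mem_preimage, mem_ofPred_eq, mem_iUnion, mem_iInter]
    have hcont : Continuous fun t : ℝ => Metric.infEDist (f ω t) Uᶜ :=
      Metric.continuous_infEDist.comp (f ω).continuous
    constructor
    · intro h
      rcases K.eq_empty_or_nonempty with rfl | hne
      · exact ⟨0, fun d => d.2.elim⟩
      · obtain ⟨t₀, ht₀, hmin⟩ := hK.exists_isMinOn hne hcont.continuousOn
        have hpos : Metric.infEDist (f ω t₀) Uᶜ ≠ 0 := by
          intro h0
          exact ((Metric.mem_iff_infEDist_zero_of_closed hU.isClosed_compl).2 h0) (h ht₀)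
        obtain ⟨n, hn⟩ := ENNReal.exists_inv_nat_lt hpos
        exact ⟨n, fun d _ => hn.le.trans (hmin d.2)⟩
    · rintro ⟨n, hn⟩ t ht
      have hcl : IsClosed {u : K | ((n : ENNReal)⁻¹) ≤ Metric.infEDist (f ω u) Uᶜ} :=
        isClosed_le continuous_const (hcont.comp continuous_subtype_val)
      have hall : ((n : ENNReal)⁻¹) ≤ Metric.infEDist (f ω t) Uᶜ := by
        have : closure s ⊆ _ := hcl.closure_subset_iff.2 hn
        exact this (hsd ⟨t, ht⟩)
      by_contra hU'
      rw [Metric.infEDist_zero_of_mem (show f ω t ∈ Uᶜ from hU')] at hall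
      simp at hall
  rw [key]
  refine MeasurableSet.iUnion fun n => MeasurableSet.biInter hsc fun d _ => ?_
  exact measurableSet_le measurable_const (Metric.continuous_infEDist.measurable.comp (hf d))

/-! ### Metric dynamical systems and random processes -/

/-- A metric dynamical system `(Ω, F, P, θ)`: a jointly measurable flow `θ` on `Ω`, indexed by `ℝ`,
which preserves `P`. -/
structure MetricDynamicalSystem {Ω : Type*} [MeasurableSpace Ω] (P : Measure Ω) where
  shift : ℝ → Ω → Ω
  measurable_shift : Measurable fun p : ℝ × Ω => shift p.1 p.2
  shift_zero : shift 0 = id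
  shift_add : ∀ t s : ℝ, shift (t + s) = shift t ∘ shift s
  map_shift : ∀ t : ℝ, P.map (shift t) = P

section Processes

variable {Ω : Type*} [MeasurableSpace Ω] {P : Measure Ω}

theorem MetricDynamicalSystem.measurePreserving (θ : MetricDynamicalSystem P) (t : ℝ) :
    MeasurePreserving (θ.shift t) P P :=
  ⟨θ.measurable_shift.comp (measurable_const.prodMk measurable_id), θ.map_shift t⟩

variable {E : Type*} [MetricSpace E]

/-- The translate `(T_t X)(s, ·) = X(t + s, θ_{-t} ·)` of a process `X : ℝ → L⁰(Ω; E)`. -/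
def translateProcess (θ : MetricDynamicalSystem P) (X : ℝ → Ω →ₘ[P] E) (t s : ℝ) : Ω →ₘ[P] E :=
  (X (t + s)).compMeasurePreserving (θ.shift (-t)) (θ.measurePreserving (-t))

/-- `X` is `θ`-almost periodic (in probability): `(t, s) ↦ X(t + s, θ_{-s} ·)` is continuous in
probability and, for every `ε > 0`, the set of the `τ` such that
`sup_t distL0 (X(t + τ, θ_{-τ} ·), X(t, ·)) ≤ ε` is relatively dense. -/
def IsShiftAlmostPeriodic (θ : MetricDynamicalSystem P) (X : ℝ → Ω →ₘ[P] E) : Prop :=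
  IsContinuousFor distL0 (fun p : ℝ × ℝ => translateProcess θ X p.2 p.1) ∧
    ∀ ε : ℝ, 0 < ε →
      IsRelativelyDense {τ : ℝ | ∀ t : ℝ, distL0 (translateProcess θ X τ t) (X t) ≤ ε}

/-- `X` is `θ`-periodic: for some `τ ≠ 0`, `X(t + τ, θ_{-τ} ·) = X(t, ·)` in `L⁰` for all `t`. -/
def IsShiftPeriodic (θ : MetricDynamicalSystem P) (X : ℝ → Ω →ₘ[P] E) : Prop :=
  ∃ τ : ℝ, τ ≠ 0 ∧ ∀ t : ℝ, translateProcess θ X τ t = X t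

/-- The law on `Eⁿ` of `(T_t X(t₁, ·), …, T_t X(tₙ, ·))`. -/
def fdLaw [IsProbabilityMeasure P] [SecondCountableTopology E] [MeasurableSpace E] [BorelSpace E]
    (θ : MetricDynamicalSystem P) (X : ℝ → Ω →ₘ[P] E) {n : ℕ} (ts : Fin n → ℝ) (t : ℝ) :
    ProbabilityMeasure (Fin n → E) :=
  ProbabilityMeasure.map (⟨P, inferInstance⟩ : ProbabilityMeasure Ω)
    (f := fun ω i => translateProcess θ X t (ts i) ω)
    (aemeasurable_pi_lambda _ fun i => (translateProcess θ X t (ts i)).aestronglyMeasurable.aemeasurable)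

/-- `X` is almost periodic in finite-dimensional distribution. The space `Eⁿ` carries the maximum
distance. -/
def IsAPFD [IsProbabilityMeasure P] [SecondCountableTopology E] [MeasurableSpace E] [BorelSpace E]
    (θ : MetricDynamicalSystem P) (X : ℝ → Ω →ₘ[P] E) : Prop :=
  ∀ (n : ℕ) (ts : Fin n → ℝ), IsAlmostPeriodic (wasserstein truncDist) (fdLaw θ X ts)

/-- `X` is periodic in finite-dimensional distribution, with a period `τ > 0` which does not depend
on the finite sequence of times. -/
def IsPFD [IsProbabilityMeasure P] [SecondCountableTopology E] [MeasurableSpace E] [BorelSpace E]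
    (θ : MetricDynamicalSystem P) (X : ℝ → Ω →ₘ[P] E) : Prop :=
  ∃ τ : ℝ, 0 < τ ∧ ∀ (n : ℕ) (ts : Fin n → ℝ) (t : ℝ), fdLaw θ X ts (t + τ) = fdLaw θ X ts t

/-- A modification of `X` all of whose trajectories are continuous. -/
structure ContinuousModification [MeasurableSpace E] (X : ℝ → Ω →ₘ[P] E) where
  path : Ω → C(ℝ, E)
  measurable_eval : ∀ t : ℝ, Measurable fun ω => path ω t
  ae_eq : ∀ t : ℝ, (fun ω => path ω t) =ᵐ[P] X t

/-- The trajectory `s ↦ X(t + s, θ_{-t} ω)` of the translate of a continuous modification. -/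
def translatePath [MeasurableSpace E] (θ : MetricDynamicalSystem P) {X : ℝ → Ω →ₘ[P] E}
    (Y : ContinuousModification X) (t : ℝ) (ω : Ω) : C(ℝ, E) :=
  (Y.path (θ.shift (-t) ω)).comp ⟨fun s : ℝ => t + s, by fun_prop⟩

theorem measurable_translatePath [SecondCountableTopology E] [MeasurableSpace E] [BorelSpace E]
    (θ : MetricDynamicalSystem P) {X : ℝ → Ω →ₘ[P] E} (Y : ContinuousModification X) (t : ℝ) :
    Measurable (translatePath θ Y t) :=
  measurable_of_measurable_eval _ fun s =>
    (Y.measurable_eval (t + s)).comp (θ.measurePreserving (-t)).measurable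

/-- The law on `C(ℝ, E)` of the translate `T_t X` of a continuous modification. -/
def pathLaw [IsProbabilityMeasure P] [SecondCountableTopology E] [MeasurableSpace E] [BorelSpace E]
    (θ : MetricDynamicalSystem P) {X : ℝ → Ω →ₘ[P] E} (Y : ContinuousModification X) (t : ℝ) :
    ProbabilityMeasure C(ℝ, E) :=
  ProbabilityMeasure.map (⟨P, inferInstance⟩ : ProbabilityMeasure Ω)
    (measurable_translatePath θ Y t).aemeasurable

/-- `X` is almost periodic in path distribution: `X` has a continuous modification, and the law on
`C(ℝ, E)` of its translates is almost periodic. -/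
def IsAPPD [IsProbabilityMeasure P] [SecondCountableTopology E] [MeasurableSpace E] [BorelSpace E]
    (θ : MetricDynamicalSystem P) (X : ℝ → Ω →ₘ[P] E) : Prop :=
  ∃ Y : ContinuousModification X, IsAlmostPeriodic (wasserstein pathDist) (pathLaw θ Y)

/-- `Z_J(t) = (ω ↦ (s ↦ X(t + s, θ_{-t} ω)))` in `L⁰(Ω; C(J; E))`, for `J = [a, b]`. -/
def translateOn [SecondCountableTopology E] [MeasurableSpace E] [BorelSpace E]
    (θ : MetricDynamicalSystem P) {X : ℝ → Ω →ₘ[P] E} (Y : ContinuousModification X)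
    (a b t : ℝ) : Ω →ₘ[P] C(Icc a b, E) :=
  AEEqFun.mk (fun ω => (translatePath θ Y t ω).restrict (Icc a b))
    ((ContinuousMap.continuous_restrict (Icc a b)).measurable.comp
      (measurable_translatePath θ Y t)).aestronglyMeasurable

end Processes

end

/-! Two random variables on the same `Ω` form a coupling, so the Wasserstein distance of their laws
is at most their expected distance (`wasserstein_le_integral`). Almost periodicity in probability
thus passes to laws, with the same almost periods up to a change of `ε`. In finite dimension, the
two variables to couple must be chosen. As the flow preserves `P`, a shift common to all components
does not affect a joint law: the law at `t + τ` is that of the `X(t + τ + tᵢ, θ_{-τ} ·)`, the law at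
`t` that of the `X(t + tᵢ, ·)`, and `θ`-almost periodicity compares exactly these. Periodicity is
the case of equality. For paths, the translates are coupled directly, and `pathDist` is cut at `[-N,
N]` with an error `2⁻ᴺ` uniform in `t`. -/

theorem IsRelativelyDense.mono {A B : Set ℝ} (h : A ⊆ B) (hA : IsRelativelyDense A) :
    IsRelativelyDense B := by
  obtain ⟨l, hl, hA⟩ := hA
  refine ⟨l, hl, fun a => ?_⟩
  obtain ⟨τ, hτ, hτI⟩ := hA a
  exact ⟨τ, h hτ, hτI⟩

/-! ### Couplings and the Wasserstein distance -/

section Wasserstein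

variable {Y : Type*} [MeasurableSpace Y] {c : Y → Y → ℝ}

theorem wasserstein_nonneg (hc : ∀ x y, 0 ≤ c x y) (μ ν : ProbabilityMeasure Y) :
    0 ≤ wasserstein c μ ν := by
  -- No coupling has to be exhibited, since `sInf ∅ = 0`.
  refine Real.sInf_nonneg ?_
  rintro _ ⟨π, -, -, rfl⟩
  exact integral_nonneg fun p => hc _ _

/-- The joint law of two random variables is a coupling of their laws. -/
theorem wasserstein_le_integral {Ω : Type*} [MeasurableSpace Ω] (P : Measure Ω)
    [IsProbabilityMeasure P] (hc : ∀ x y, 0 ≤ c x y)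
    (hcm : Measurable fun p : Y × Y => c p.1 p.2) {μ ν : ProbabilityMeasure Y} {f g : Ω → Y}
    (hf : AEMeasurable f P) (hg : AEMeasurable g P)
    (hμ : (μ : Measure Y) = P.map f) (hν : (ν : Measure Y) = P.map g) :
    wasserstein c μ ν ≤ ∫ ω, c (f ω) (g ω) ∂P := by
  refine csInf_le ⟨0, ?_⟩
    ⟨ProbabilityMeasure.map (⟨P, inferInstance⟩ : ProbabilityMeasure Ω) (hf.prodMk hg), ?_, ?_, ?_⟩
  · rintro _ ⟨π, -, -, rfl⟩
    exact integral_nonneg fun p => hc _ _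
  · apply Subtype.ext
    change (P.map fun ω => (f ω, g ω)).map Prod.fst = μ
    rw [hμ, AEMeasurable.map_map_of_aemeasurable measurable_fst.aemeasurable (hf.prodMk hg)]
    rfl
  · apply Subtype.ext
    change (P.map fun ω => (f ω, g ω)).map Prod.snd = ν
    rw [hν, AEMeasurable.map_map_of_aemeasurable measurable_snd.aemeasurable (hf.prodMk hg)]
    rfl
  · change _ = ∫ p, c p.1 p.2 ∂(P.map fun ω => (f ω, g ω))
    rw [integral_map (hf.prodMk hg) hcm.aestronglyMeasurable]

end Wasserstein

/-! ### The truncated distance -/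

section TruncatedDistance

theorem truncDist_nonneg {Y : Type*} [MetricSpace Y] (x y : Y) : 0 ≤ truncDist x y :=
  le_min dist_nonneg zero_le_one

theorem measurable_truncDist {Y : Type*} [MetricSpace Y] [SecondCountableTopology Y]
    [MeasurableSpace Y] [BorelSpace Y] : Measurable fun p : Y × Y => truncDist p.1 p.2 :=
  (continuous_dist.min continuous_const).measurable

/-- The truncated maximum distance is at most the sum of the truncated distances. -/
theorem truncDist_pi_le_sum {ι Y : Type*} [Fintype ι] [MetricSpace Y] (x y : ι → Y) :
    truncDist x y ≤ ∑ i, truncDist (x i) (y i) := by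
  have hnn : ∀ i ∈ Finset.univ, 0 ≤ truncDist (x i) (y i) := fun i _ => truncDist_nonneg _ _
  by_cases h : 1 ≤ ∑ i, truncDist (x i) (y i)
  · exact (min_le_right _ _).trans h
  -- When the sum is below 1, no term is truncated, so each one is the true distance.
  · push Not at h
    refine (min_le_left _ _).trans ((dist_pi_le_iff (Finset.sum_nonneg hnn)).2 fun i => ?_)
    have hi := Finset.single_le_sum hnn (Finset.mem_univ i)
    rcases min_choice (dist (x i) (y i)) 1 with h' | h'
    · exact h'.symm.le.trans hi
    · have : truncDist (x i) (y i) = 1 := h'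
      linarith

variable {Ω Y : Type*} [MeasurableSpace Ω] {P : Measure Ω} [MetricSpace Y]

theorem integrable_truncDist [IsFiniteMeasure P] {f g : Ω → Y}
    (hf : AEStronglyMeasurable f P) (hg : AEStronglyMeasurable g P) :
    Integrable (fun ω => truncDist (f ω) (g ω)) P := by
  refine Integrable.of_bound ((hf.dist hg).inf aestronglyMeasurable_const) 1
    (Eventually.of_forall fun ω => ?_)
  rw [Real.norm_of_nonneg (truncDist_nonneg _ _)]
  exact min_le_right _ _

theorem distL0_eq_integral_truncDist (f g : Ω →ₘ[P] Y) :
    distL0 f g = ∫ ω, truncDist (f ω) (g ω) ∂P := rfl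

end TruncatedDistance

/-! ### Finite-dimensional laws -/

section FiniteDimensional

variable {Ω : Type*} [MeasurableSpace Ω] {P : Measure Ω}
  {E : Type*} [MetricSpace E] [MeasurableSpace E] [BorelSpace E]

theorem aemeasurable_pi_aeEqFun {ι : Type*} [Countable ι] (f : ι → Ω →ₘ[P] E) :
    AEMeasurable (fun ω i => f i ω) P :=
  aemeasurable_pi_lambda _ fun i => (f i).aestronglyMeasurable.aemeasurable

/-- The joint law of a family of random variables is invariant under the shift. -/
theorem map_pi_compMeasurePreserving {ι : Type*} [Countable ι] (f : ι → Ω →ₘ[P] E)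
    {φ : Ω → Ω} (hφ : MeasurePreserving φ P P) :
    P.map (fun ω i => (f i).compMeasurePreserving φ hφ ω) = P.map (fun ω i => f i ω) := by
  have h : (fun ω i => (f i).compMeasurePreserving φ hφ ω) =ᵐ[P]
      (fun ω i => f i ω) ∘ φ := by
    filter_upwards [ae_all_iff.2 fun i => (f i).coeFn_compMeasurePreserving hφ] with ω hω
    exact funext hω
  rw [Measure.map_congr h, ← AEMeasurable.map_map_of_aemeasurable _ hφ.aemeasurable, hφ.map_eq]
  rw [hφ.map_eq]
  exact aemeasurable_pi_aeEqFun f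

variable [SecondCountableTopology E] [IsProbabilityMeasure P] (θ : MetricDynamicalSystem P) (X : ℝ → Ω →ₘ[P] E) {n : ℕ}

theorem coe_fdLaw (ts : Fin n → ℝ) (t : ℝ) :
    (fdLaw θ X ts t : Measure (Fin n → E)) =
      P.map (fun ω i => translateProcess θ X t (ts i) ω) := rfl

theorem coe_fdLaw_eq_map (ts : Fin n → ℝ) (t : ℝ) :
    (fdLaw θ X ts t : Measure (Fin n → E)) = P.map (fun ω i => X (t + ts i) ω) :=
  map_pi_compMeasurePreserving (fun i => X (t + ts i)) (θ.measurePreserving (-t))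

/-- The common shift by `-(t + τ)` is removed and one by `-τ` inserted, which gives the variables
that the definition of `θ`-almost periods controls. -/
theorem coe_fdLaw_add (ts : Fin n → ℝ) (t τ : ℝ) :
    (fdLaw θ X ts (t + τ) : Measure (Fin n → E)) =
      P.map (fun ω i => translateProcess θ X τ (t + ts i) ω) := by
  simp_rw [coe_fdLaw_eq_map, show ∀ i, t + τ + ts i = τ + (t + ts i) from fun i => by ring]
  exact (map_pi_compMeasurePreserving (fun i => X (τ + (t + ts i))) (θ.measurePreserving (-τ))).symm

/-- The Wasserstein distance of two joint laws is at most the sum of the distances in probability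
of the components. -/
theorem wasserstein_truncDist_le_sum_distL0 {μ ν : ProbabilityMeasure (Fin n → E)}
    (f g : Fin n → Ω →ₘ[P] E) (hμ : (μ : Measure (Fin n → E)) = P.map (fun ω i => f i ω))
    (hν : (ν : Measure (Fin n → E)) = P.map (fun ω i => g i ω)) :
    wasserstein truncDist μ ν ≤ ∑ i, distL0 (f i) (g i) := by
  refine (wasserstein_le_integral P truncDist_nonneg measurable_truncDist
    (aemeasurable_pi_aeEqFun f) (aemeasurable_pi_aeEqFun g) hμ hν).trans ?_
  have hint : ∀ i, Integrable (fun ω => truncDist (f i ω) (g i ω)) P := fun i =>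
    integrable_truncDist (f i).aestronglyMeasurable (g i).aestronglyMeasurable
  simp only [distL0_eq_integral_truncDist]
  rw [← integral_finsetSum _ fun i _ => hint i]
  exact integral_mono
    (integrable_truncDist (aemeasurable_pi_aeEqFun f).aestronglyMeasurable
      (aemeasurable_pi_aeEqFun g).aestronglyMeasurable)
    (integrable_finsetSum _ fun i _ => hint i) fun ω => truncDist_pi_le_sum _ _

variable {θ X}

theorem IsShiftAlmostPeriodic.isAPFD (h : IsShiftAlmostPeriodic θ X) : IsAPFD θ X := by
  intro n ts
  refine ⟨fun t₀ => ?_, fun ε hε => ?_⟩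
  · have hi : ∀ i, Tendsto (fun t => distL0 (translateProcess θ X t (ts i))
        (translateProcess θ X t₀ (ts i))) (𝓝 t₀) (𝓝 0) := by
      intro i
      -- Joint continuity is only used along the line where the first variable is `ts i`.
      have hc : Tendsto (fun t : ℝ => (ts i, t)) (𝓝 t₀) (𝓝 (ts i, t₀)) :=
        tendsto_const_nhds.prodMk_nhds tendsto_id
      have ht := h.1 (ts i, t₀)
      have := ht.comp hc
      simp only [Function.comp_def] at this
      exact this
    have hlim : Tendsto (fun t => ∑ i, distL0 (translateProcess θ X t (ts i))
        (translateProcess θ X t₀ (ts i))) (𝓝 t₀) (𝓝 0) := by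
      simpa only [Finset.sum_const_zero] using tendsto_finsetSum Finset.univ fun i _ => hi i
    exact squeeze_zero (fun t => wasserstein_nonneg truncDist_nonneg _ _)
      (fun t => wasserstein_truncDist_le_sum_distL0 _ _ (coe_fdLaw θ X ts t)
        (coe_fdLaw θ X ts t₀)) hlim
  -- Dividing by `n + 1` rather than `n` covers the empty family of times.
  · have hn : (0 : ℝ) < n + 1 := by positivity
    refine (h.2 (ε / (n + 1)) (by positivity)).mono fun τ hτ t => ?_
    refine (wasserstein_truncDist_le_sum_distL0 _ _ (coe_fdLaw_add θ X ts t τ)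
      (coe_fdLaw_eq_map θ X ts t)).trans ?_
    calc ∑ i, distL0 (translateProcess θ X τ (t + ts i)) (X (t + ts i))
        ≤ ∑ _i : Fin n, ε / (n + 1) := Finset.sum_le_sum fun i _ => hτ (t + ts i)
      _ = n * (ε / (n + 1)) := by simp
      _ ≤ (n + 1) * (ε / (n + 1)) := by gcongr; linarith
      _ = ε := by field_simp

theorem IsShiftPeriodic.isPFD (h : IsShiftPeriodic θ X) : IsPFD θ X := by
  obtain ⟨τ, hτ0, hτ⟩ := h
  have key : ∀ (n : ℕ) (ts : Fin n → ℝ) (t : ℝ), fdLaw θ X ts (t + τ) = fdLaw θ X ts t := by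
    intro n ts t
    apply Subtype.ext
    change (fdLaw θ X ts (t + τ) : Measure (Fin n → E)) = (fdLaw θ X ts t : Measure (Fin n → E))
    rw [coe_fdLaw_add, coe_fdLaw_eq_map]
    simp only [hτ]
  rcases lt_or_gt_of_ne hτ0 with h | h
  -- A negative period is replaced by its opposite.
  · refine ⟨-τ, neg_pos.2 h, fun n ts t => ?_⟩
    rw [← key n ts (t + -τ), neg_add_cancel_right]
  · exact ⟨τ, h, key⟩

end FiniteDimensional

/-! ### The distance on path space -/

section PathDistance

variable {E : Type*} [MetricSpace E]

theorem summable_half_pow_succ : Summable fun k : ℕ => (1 / 2 : ℝ) ^ (k + 1) :=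
  (summable_nat_add_iff 1).2 summable_geometric_two

/-- Bounds the tail of `pathDist`; the case `N = 0` gives its total weight 1. -/
theorem tsum_half_pow_succ_add (N : ℕ) :
    ∑' k : ℕ, (1 / 2 : ℝ) ^ (k + N + 1) = (1 / 2) ^ N := by
  simp_rw [show ∀ k : ℕ, (1 / 2 : ℝ) ^ (k + N + 1) = (1 / 2) ^ k * (1 / 2) ^ (N + 1) from
    fun k => by ring]
  rw [tsum_mul_right, tsum_geometric_two]
  ring

theorem pathDist_nonneg (x y : C(ℝ, E)) : 0 ≤ pathDist x y :=
  tsum_nonneg fun _ => mul_nonneg (by positivity) (truncDist_nonneg _ _)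

theorem pathDist_term_le (x y : C(ℝ, E)) (k : ℕ) :
    (1 / 2 : ℝ) ^ (k + 1) * truncDist (x.restrict (Icc (-((k : ℝ) + 1)) ((k : ℝ) + 1)))
      (y.restrict (Icc (-((k : ℝ) + 1)) ((k : ℝ) + 1))) ≤ (1 / 2) ^ (k + 1) :=
  mul_le_of_le_one_right (by positivity) (min_le_right _ _)

theorem summable_pathDist (x y : C(ℝ, E)) : Summable fun k : ℕ => (1 / 2 : ℝ) ^ (k + 1) *
    truncDist (x.restrict (Icc (-((k : ℝ) + 1)) ((k : ℝ) + 1)))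
      (y.restrict (Icc (-((k : ℝ) + 1)) ((k : ℝ) + 1))) :=
  summable_half_pow_succ.of_nonneg_of_le
    (fun _ => mul_nonneg (by positivity) (truncDist_nonneg _ _)) (pathDist_term_le x y)

/-- Weierstrass test. Continuity provides the measurability of the cost that the coupling bound
requires. -/
theorem continuous_pathDist : Continuous fun p : C(ℝ, E) × C(ℝ, E) => pathDist p.1 p.2 := by
  refine continuous_tsum (fun k => ?_) summable_half_pow_succ fun k p => ?_
  · refine continuous_const.mul (Continuous.min (Continuous.dist ?_ ?_) continuous_const)
    · exact (ContinuousMap.continuous_restrict _).comp continuous_fst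
    · exact (ContinuousMap.continuous_restrict _).comp continuous_snd
  · rw [Real.norm_of_nonneg (by positivity)]
    exact pathDist_term_le p.1 p.2 k

theorem truncDist_restrict_mono (x y : C(ℝ, E)) {a b a' b' : ℝ} (h : Icc a b ⊆ Icc a' b') :
    truncDist (x.restrict (Icc a b)) (y.restrict (Icc a b)) ≤
      truncDist (x.restrict (Icc a' b')) (y.restrict (Icc a' b')) := by
  refine min_le_min_right 1 ((ContinuousMap.dist_le dist_nonneg).2 fun s => ?_)
  exact ContinuousMap.dist_apply_le_dist (f := x.restrict (Icc a' b'))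
    (g := y.restrict (Icc a' b')) ⟨s, h s.2⟩

/-- The path distance is controlled by the uniform distance on a large interval. -/
theorem pathDist_le_truncDist_add (x y : C(ℝ, E)) (N : ℕ) :
    pathDist x y ≤ truncDist (x.restrict (Icc (-(N : ℝ)) N)) (y.restrict (Icc (-(N : ℝ)) N)) +
      (1 / 2) ^ N := by
  set D := truncDist (x.restrict (Icc (-(N : ℝ)) N)) (y.restrict (Icc (-(N : ℝ)) N))
  have hD : 0 ≤ D := truncDist_nonneg _ _
  change ∑' k : ℕ, (1 / 2 : ℝ) ^ (k + 1) *
    truncDist (x.restrict (Icc (-((k : ℝ) + 1)) ((k : ℝ) + 1)))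
      (y.restrict (Icc (-((k : ℝ) + 1)) ((k : ℝ) + 1))) ≤ _
  -- The term of index `k` lives on `[-(k + 1), k + 1]`, which is inside `[-N, N]` exactly when `k <
  -- N`; the later terms are bounded by their weights.
  rw [← (summable_pathDist x y).sum_add_tsum_nat_add N]
  refine add_le_add ?_ ?_
  · calc _ ≤ ∑ k ∈ Finset.range N, (1 / 2 : ℝ) ^ (k + 1) * D := by
          refine Finset.sum_le_sum fun k hk => mul_le_mul_of_nonneg_left ?_ (by positivity)
          have hkN : (k : ℝ) + 1 ≤ N := by exact_mod_cast Finset.mem_range.1 hk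
          exact truncDist_restrict_mono x y (Icc_subset_Icc (neg_le_neg hkN) hkN)
      _ = (∑ k ∈ Finset.range N, (1 / 2 : ℝ) ^ (k + 1)) * D := (Finset.sum_mul _ _ _).symm
      _ ≤ 1 * D := by
          refine mul_le_mul_of_nonneg_right ?_ hD
          refine (summable_half_pow_succ.sum_le_tsum _ fun _ _ => by positivity).trans_eq ?_
          simpa using tsum_half_pow_succ_add 0
      _ = D := one_mul D
  · rw [← tsum_half_pow_succ_add N]
    exact ((summable_nat_add_iff N).2 (summable_pathDist x y)).tsum_le_tsum
      (fun k => pathDist_term_le x y (k + N))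
      ((summable_nat_add_iff N).2 summable_half_pow_succ)

end PathDistance

/-! ### Path laws -/

section Path

variable {Ω : Type*} [MeasurableSpace Ω] {P : Measure Ω} [IsProbabilityMeasure P]
  {E : Type*} [MetricSpace E] [SecondCountableTopology E] [MeasurableSpace E] [BorelSpace E]
  (θ : MetricDynamicalSystem P) {X : ℝ → Ω →ₘ[P] E} (Y : ContinuousModification X)

/-- The coupling is the pair of translates at `t` and `u` on `Ω` itself. Invariance of `P` is not
used to change the laws, because `translateOn` already contains the shifts. -/
theorem wasserstein_pathLaw_le (t u : ℝ) (N : ℕ) :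
    wasserstein pathDist (pathLaw θ Y t) (pathLaw θ Y u) ≤
      distL0 (translateOn θ Y (-(N : ℝ)) N t) (translateOn θ Y (-(N : ℝ)) N u) + (1 / 2) ^ N := by
  have hm := measurable_translatePath θ Y
  refine (wasserstein_le_integral P pathDist_nonneg continuous_pathDist.measurable
    (hm t).aemeasurable (hm u).aemeasurable rfl rfl).trans ?_
  have hr : ∀ v, AEStronglyMeasurable
      (fun ω => (translatePath θ Y v ω).restrict (Icc (-(N : ℝ)) N)) P := fun v =>
    ((ContinuousMap.continuous_restrict _).measurable.comp (hm v)).aestronglyMeasurable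
  have hd : distL0 (translateOn θ Y (-(N : ℝ)) N t) (translateOn θ Y (-(N : ℝ)) N u) =
      ∫ ω, truncDist ((translatePath θ Y t ω).restrict (Icc (-(N : ℝ)) N))
        ((translatePath θ Y u ω).restrict (Icc (-(N : ℝ)) N)) ∂P := by
    refine integral_congr_ae ?_
    filter_upwards [AEEqFun.coeFn_mk _ (hr t), AEEqFun.coeFn_mk _ (hr u)] with ω h₁ h₂
    unfold translateOn truncDist
    rw [h₁, h₂]
  have hint := integrable_truncDist (hr t) (hr u)
  calc _ ≤ ∫ ω, (truncDist ((translatePath θ Y t ω).restrict (Icc (-(N : ℝ)) N))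
        ((translatePath θ Y u ω).restrict (Icc (-(N : ℝ)) N)) + (1 / 2) ^ N) ∂P :=
        integral_mono_of_nonneg (Eventually.of_forall fun ω => pathDist_nonneg _ _)
          (hint.add (integrable_const _))
          (Eventually.of_forall fun ω => pathDist_le_truncDist_add _ _ N)
    _ = _ := by rw [integral_add hint (integrable_const _), hd]; simp

theorem exists_half_pow_lt {ε : ℝ} (hε : 0 < ε) : ∃ N : ℕ, (1 / 2 : ℝ) ^ N < ε :=
  exists_pow_lt_of_lt_one hε (by norm_num)

/-- Half of `ε` pays for the tail `2⁻ᴺ`, half for the distance on `[-N, N]`. As `N` depends on `ε`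
only, the `ε / 2`-almost periods on `[-N, N]` are `ε`-almost periods of the law. -/
theorem isAlmostPeriodic_pathLaw
    (h : ∀ a b : ℝ, a ≤ b → IsAlmostPeriodic distL0 (translateOn θ Y a b)) :
    IsAlmostPeriodic (wasserstein pathDist) (pathLaw θ Y) := by
  have hN : ∀ N : ℕ, IsAlmostPeriodic distL0 (translateOn θ Y (-(N : ℝ)) N) := fun N =>
    h _ _ (neg_le_self N.cast_nonneg)
  refine ⟨fun t₀ => ?_, fun ε hε => ?_⟩
  · refine tendsto_order.2 ⟨fun a ha => Eventually.of_forall fun t =>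
      ha.trans_le (wasserstein_nonneg pathDist_nonneg _ _), fun ε hε => ?_⟩
    obtain ⟨N, hNε⟩ := exists_half_pow_lt (half_pos hε)
    filter_upwards [((hN N).1 t₀).eventually (gt_mem_nhds (half_pos hε))] with t ht
    linarith [wasserstein_pathLaw_le θ Y t t₀ N]
  · obtain ⟨N, hNε⟩ := exists_half_pow_lt (half_pos hε)
    refine ((hN N).2 (ε / 2) (half_pos hε)).mono fun τ hτ t => ?_
    linarith [wasserstein_pathLaw_le θ Y (t + τ) t N, hτ t]

end Path

theorem theorem4p3 {Ω : Type*} [MeasurableSpace Ω] (P : Measure Ω) [IsProbabilityMeasure P]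
    (θ : MetricDynamicalSystem P)
    {E : Type*} [MetricSpace E] [CompleteSpace E] [SecondCountableTopology E]
    [MeasurableSpace E] [BorelSpace E]
    (X : ℝ → Ω →ₘ[P] E) :
    (IsShiftAlmostPeriodic θ X → IsAPFD θ X) ∧
    (IsShiftPeriodic θ X → IsPFD θ X) ∧
    (∀ Y : ContinuousModification X,
      (∀ a b : ℝ, a ≤ b → IsAlmostPeriodic distL0 (translateOn θ Y a b)) → IsAPPD θ X) := by

  exact ⟨IsShiftAlmostPeriodic.isAPFD, IsShiftPeriodic.isPFD,
    fun Y h => ⟨Y, isAlmostPeriodic_pathLaw θ Y h⟩⟩
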